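/- Let $A>0$ and $s>0$. There is a constant $c=c(A,s)>0$ such that the following holds for every $n\ge 1$ and every family $X_1,\dots,X_n$ of independent real random variables, on any probability space, satisfying $$E(X_i)=0,\qquad E(X_i^4)\le A,\qquad E(X_i\mathbf 1_{X_i>0})\ge s,\qquad i=1,\dots,n .$$ For $u\in\mathbb R$ let $P_u$ denote the law under which the walk starts at $S_0=u$ and $S_k=u+X_1+\dots+X_k$ for $1\le k\le n$, and let $\tau=\min\{k\ge 1: S_k<0\}$, so that $\{\tau>n\}=\{S_1\ge 0,\dots,S_n\ge 0\}$. Then, for every real $u\ge 0$, $$P_u(\tau>n)\le \frac{c\,(u+1)}{\sqrt n}.$$ -/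

import Mathlib

open MeasureTheory ProbabilityTheory

/-- The walk with increments `X 1, X 2, …` started at `u`: `S_k = u + X_1 + ⋯ + X_k`. -/
def walk {Ω : Type*} (X : ℕ → Ω → ℝ) (u : ℝ) (k : ℕ) (ω : Ω) : ℝ :=
  u + ∑ i ∈ Finset.Icc 1 k, X i ω

/-- The first time `k ≥ 1` at which the walk started at `u` is strictly negative
(`⊤` if there is no such time). -/
noncomputable def firstNegTime {Ω : Type*} (X : ℕ → Ω → ℝ) (u : ℝ) : Ω → WithTop ℕ :=
  hittingAfter (walk X u) (Set.Iio 0) 1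

open scoped ENNReal

/-! Write `E` for survival up to time `n`. The expectation of `S_n⁺` on `E` is bounded from both
sides. Above: `V(x) = z + log z` with `z = x + R` dominates `x⁺` and, for `R` large in terms of `A`
and `s`, is superharmonic on the half-line for every increment: the concavity of `log` gains order
`z⁻²`, the fourth-moment error costs order `z⁻³` (`lyapunov_add_le`, `lintegral_lyapunov_add_le`).
So the killed walk gives at most `V(u)`, which is `O(u + 1)`. Below: survival favours high
positions, so the expectation is at least `P(E)` times the unconditional mean of `S_n⁺`
(`measure_mul_lintegral_walk_le`), and that mean has order at least `√n` by comparing second and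
fourth moments (`walk_moments`, `integral_max_ge`). Dividing gives the bound. -/

/-- The event that the walk is nonnegative at all times `1, …, k`. -/
def nonnegUpTo {Ω : Type*} (X : ℕ → Ω → ℝ) (u : ℝ) (k : ℕ) : Set Ω :=
  {ω | ∀ j ∈ Finset.Icc 1 k, 0 ≤ walk X u j ω}

/-! ### The killed walk: Markov property, stochastic monotonicity, supermartingales. -/

section Walk

variable {Ω : Type*} {X : ℕ → Ω → ℝ} {u : ℝ} {n k : ℕ}

lemma walk_zero (ω : Ω) : walk X u 0 ω = u := by simp [walk]

lemma walk_succ (ω : Ω) : walk X u (k + 1) ω = walk X u k ω + X (k + 1) ω := by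
  simp [walk, Finset.sum_Icc_succ_top, add_assoc]

lemma nonnegUpTo_zero : nonnegUpTo X u 0 = Set.univ := by
  ext ω; simp [nonnegUpTo]

lemma nonnegUpTo_succ :
    nonnegUpTo X u (k + 1) = nonnegUpTo X u k ∩ {ω | 0 ≤ walk X u (k + 1) ω} := by
  ext ω
  simp only [nonnegUpTo, Set.mem_ofPred_eq, Set.mem_inter_iff, Finset.mem_Icc]
  constructor
  · exact fun h => ⟨fun j hj => h j ⟨hj.1, by omega⟩, h _ ⟨by omega, le_rfl⟩⟩
  · rintro ⟨h1, h2⟩ j hj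
    rcases eq_or_lt_of_le hj.2 with rfl | h
    · exact h2
    · exact h1 j ⟨hj.1, by omega⟩

lemma walk_nonneg_of_mem (hu : 0 ≤ u) {ω : Ω} (h : ω ∈ nonnegUpTo X u k) :
    0 ≤ walk X u k ω := by
  rcases Nat.eq_zero_or_pos k with rfl | hk
  · rwa [walk_zero]
  · exact h k (by simp; omega)

lemma lt_firstNegTime_subset :
    {ω | (n : WithTop ℕ) < firstNegTime X u ω} ⊆ nonnegUpTo X u n := by
  intro ω h j hj
  rw [Finset.mem_Icc] at hj
  have h' : (j : WithTop ℕ) < hittingAfter (walk X u) (Set.Iio 0) 1 ω :=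
    lt_of_le_of_lt (by exact_mod_cast hj.2) h
  simpa using notMem_of_lt_hittingAfter h' hj.1

variable [MeasurableSpace Ω]

lemma measurable_walk (hX : ∀ i ∈ Finset.Icc 1 n, Measurable (X i)) (hk : k ≤ n) :
    Measurable (walk X u k) := by
  unfold walk
  refine measurable_const.add (Finset.measurable_sum _ fun i hi => hX i ?_)
  simp only [Finset.mem_Icc] at hi ⊢
  omega

lemma measurableSet_nonnegUpTo (hX : ∀ i ∈ Finset.Icc 1 n, Measurable (X i)) (hk : k ≤ n) :
    MeasurableSet (nonnegUpTo X u k) := by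
  have : nonnegUpTo X u k = ⋂ j ∈ Finset.Icc 1 k, {ω | 0 ≤ walk X u j ω} := by
    ext; simp [nonnegUpTo]
  rw [this]
  refine Finset.measurableSet_biInter _ fun j hj => measurableSet_le measurable_const ?_
  simp only [Finset.mem_Icc] at hj
  exact measurable_walk hX (by omega)

/-- The past of the walk (its position and the survival indicator) is independent of the next
increment. -/
lemma indepFun_walk_indicator {P : Measure Ω}
    (hX : ∀ i ∈ Finset.Icc 1 n, Measurable (X i))
    (hind : iIndepFun (fun i : Finset.Icc 1 n => X i) P) (hk : k < n) :
    IndepFun (fun ω => (walk X u k ω, (nonnegUpTo X u k).indicator (1 : Ω → ℝ≥0∞) ω))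
      (X (k + 1)) P := by
  classical
  let S : Finset (Finset.Icc 1 n) := Finset.univ.filter fun i => i.1 ≤ k
  let a : Finset.Icc 1 n := ⟨k + 1, by simp; omega⟩
  have hS : Disjoint S {a} := by simp [S, a]
  have hI := hind.indepFun_finset S {a} hS fun i => hX i i.2
  -- Padding by zeros lets `walk` and `nonnegUpTo` be reused on the space of the first `k`
  -- increments; the padding is never read up to time `k`.
  let ext : (S → ℝ) → ℕ → ℝ := fun p i =>
    if h : ∃ hi : i ∈ Finset.Icc 1 n, (⟨i, hi⟩ : Finset.Icc 1 n) ∈ S then p ⟨⟨i, h.1⟩, h.2⟩ else 0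
  have hext : ∀ i, Measurable fun p => ext p i := by
    intro i
    by_cases h : ∃ hi : i ∈ Finset.Icc 1 n, (⟨i, hi⟩ : Finset.Icc 1 n) ∈ S
    · simp only [ext, h, dif_pos]; exact measurable_pi_apply _
    · simp only [ext, h, dif_neg, not_false_eq_true]; exact measurable_const
  let W : ℕ → (S → ℝ) → ℝ := walk (fun i p => ext p i) u
  have hW : ∀ j, Measurable (W j) := fun j =>
    measurable_walk (n := j) (fun i _ => hext i) le_rfl
  let pre : Ω → S → ℝ := fun ω i => X i ω
  have hpre : ∀ j ≤ k, ∀ ω, walk X u j ω = W j (pre ω) := by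
    intro j hj ω
    simp only [W, walk]
    congr 1
    refine Finset.sum_congr rfl fun i hi => ?_
    simp only [Finset.mem_Icc] at hi
    have h : ∃ hi : i ∈ Finset.Icc 1 n, (⟨i, hi⟩ : Finset.Icc 1 n) ∈ S :=
      ⟨by simp; omega, by simp [S]; omega⟩
    simp only [ext, h, dif_pos, pre]
  have hind' : ∀ ω, (nonnegUpTo X u k).indicator (1 : Ω → ℝ≥0∞) ω
      = (nonnegUpTo (fun i p => ext p i) u k).indicator (1 : (S → ℝ) → ℝ≥0∞) (pre ω) := by
    intro ω
    have : ω ∈ nonnegUpTo X u k ↔ pre ω ∈ nonnegUpTo (fun i p => ext p i) u k := by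
      simp only [nonnegUpTo, Set.mem_ofPred_eq, Finset.mem_Icc]
      exact forall₂_congr fun j hj => by rw [hpre j hj.2]
    simp [Set.indicator_apply, this]
  have hmeas : Measurable fun p : S → ℝ =>
      (W k p, (nonnegUpTo (fun i p => ext p i) u k).indicator (1 : (S → ℝ) → ℝ≥0∞) p) :=
    (hW k).prodMk (measurable_one.indicator
      (measurableSet_nonnegUpTo (n := k) (fun i _ => hext i) le_rfl))
  have := hI.comp hmeas (measurable_pi_apply (⟨a, by simp⟩ : ({a} : Finset (Finset.Icc 1 n))))
  simp_rw [hpre k le_rfl, hind']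
  exact this

lemma setLIntegral_eq_of_indepFun {P : Measure Ω} [IsProbabilityMeasure P] {T Y : Ω → ℝ}
    {E : Set Ω} (hT : Measurable T) (hY : Measurable Y) (hE : MeasurableSet E)
    (h : IndepFun (fun ω => (T ω, E.indicator (1 : Ω → ℝ≥0∞) ω)) Y P)
    {F : ℝ → ℝ≥0∞} (hF : Measurable F) :
    ∫⁻ ω in E, F (T ω + Y ω) ∂P = ∫⁻ ω in E, ∫⁻ ω', F (T ω + Y ω') ∂P ∂P := by
  have hm : Measurable fun ω => (T ω, E.indicator (1 : Ω → ℝ≥0∞) ω) :=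
    hT.prodMk (measurable_one.indicator hE)
  have hmap := h.map_prod_eq_prod_map_map hm.aemeasurable hY.aemeasurable
  have key : ∀ (G : Ω → ℝ≥0∞), ∫⁻ ω in E, G ω ∂P
      = ∫⁻ ω, E.indicator (1 : Ω → ℝ≥0∞) ω * G ω ∂P := by
    intro G
    rw [← lintegral_indicator hE]
    congr 1; ext ω
    by_cases hω : ω ∈ E <;> simp [hω]
  have hG : Measurable fun q : (ℝ × ℝ≥0∞) × ℝ => q.1.2 * F (q.1.1 + q.2) := by fun_prop
  rw [key, key]
  calc _ = ∫⁻ q, q.1.2 * F (q.1.1 + q.2)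
        ∂(P.map fun ω => ((T ω, E.indicator (1 : Ω → ℝ≥0∞) ω), Y ω)) := by
        rw [lintegral_map hG (hm.prodMk hY)]
    _ = _ := by
        rw [hmap, lintegral_prod _ hG.aemeasurable, lintegral_map hG.lintegral_prod_right' hm]
        congr 1; ext ω
        rw [lintegral_map (by fun_prop) hY, lintegral_const_mul _ (by fun_prop)]

/-- One step of the walk, on the survival event. -/
lemma setLIntegral_walk_succ {P : Measure Ω} [IsProbabilityMeasure P]
    (hX : ∀ i ∈ Finset.Icc 1 n, Measurable (X i))
    (hind : iIndepFun (fun i : Finset.Icc 1 n => X i) P) (hk : k < n)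
    {F : ℝ → ℝ≥0∞} (hF : Measurable F) :
    ∫⁻ ω in nonnegUpTo X u k, F (walk X u (k + 1) ω) ∂P
      = ∫⁻ ω in nonnegUpTo X u k, ∫⁻ ω', F (walk X u k ω + X (k + 1) ω') ∂P ∂P := by
  simp_rw [walk_succ]
  exact setLIntegral_eq_of_indepFun (measurable_walk hX hk.le) (hX _ (by simp; omega))
    (measurableSet_nonnegUpTo hX hk.le) (indepFun_walk_indicator hX hind hk) hF

lemma indepFun_walk {P : Measure Ω} (hX : ∀ i ∈ Finset.Icc 1 n, Measurable (X i))
    (hind : iIndepFun (fun i : Finset.Icc 1 n => X i) P) (hk : k < n) :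
    IndepFun (walk X u k) (X (k + 1)) P :=
  (indepFun_walk_indicator hX hind hk).comp measurable_fst measurable_id

lemma lintegral_walk_succ {P : Measure Ω} [IsProbabilityMeasure P]
    (hX : ∀ i ∈ Finset.Icc 1 n, Measurable (X i))
    (hind : iIndepFun (fun i : Finset.Icc 1 n => X i) P) (hk : k < n)
    {F : ℝ → ℝ≥0∞} (hF : Measurable F) :
    ∫⁻ ω, F (walk X u (k + 1) ω) ∂P
      = ∫⁻ ω, ∫⁻ ω', F (walk X u k ω + X (k + 1) ω') ∂P ∂P := by
  simp_rw [walk_succ]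
  have h : IndepFun (fun ω => (walk X u k ω, Set.univ.indicator (1 : Ω → ℝ≥0∞) ω))
      (X (k + 1)) P := by
    simpa [Function.comp_def] using (indepFun_walk hX hind hk).comp
      (measurable_id.prodMk measurable_const : Measurable fun x : ℝ => (x, (1 : ℝ≥0∞)))
      measurable_id
  simpa using setLIntegral_eq_of_indepFun (measurable_walk hX hk.le) (hX _ (by simp; omega))
    MeasurableSet.univ h hF

/-- The discarded part has `f (T ω) ≤ f 0` and the kept part has `f (T ω) ≥ f 0`, so discarding
raises the average. The product form avoids dividing by a null probability. -/
lemma measure_mul_lintegral_le_of_monotone {P : Measure Ω} [IsFiniteMeasure P] {E : Set Ω}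
    {T : Ω → ℝ} (hT : Measurable T) {f : ℝ → ℝ≥0∞} (hf : Monotone f) :
    P (E ∩ {ω | 0 ≤ T ω}) * ∫⁻ ω in E, f (T ω) ∂P
      ≤ P E * ∫⁻ ω in E ∩ {ω | 0 ≤ T ω}, f (T ω) ∂P := by
  have hI : MeasurableSet {ω | 0 ≤ T ω} := measurableSet_le measurable_const hT
  set I := {ω | 0 ≤ T ω}
  have h1 : ∫⁻ ω in E \ I, f (T ω) ∂P ≤ f 0 * P (E \ I) := by
    rw [← setLIntegral_const]
    rw [Set.sdiff_eq, Set.inter_comm, ← Measure.restrict_restrict hI.compl]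
    exact setLIntegral_mono' hI.compl fun ω hω => hf (le_of_lt (not_le.1 hω))
  have h2 : f 0 * P (E ∩ I) ≤ ∫⁻ ω in E ∩ I, f (T ω) ∂P := by
    rw [← setLIntegral_const]
    rw [Set.inter_comm, ← Measure.restrict_restrict hI]
    exact setLIntegral_mono' hI fun ω hω => hf hω
  rw [← lintegral_inter_add_sdiff (μ := P) _ E hI, ← measure_inter_add_sdiff E hI (μ := P),
    mul_add, add_mul]
  gcongr _ + ?_
  calc P (E ∩ I) * ∫⁻ ω in E \ I, f (T ω) ∂P ≤ P (E ∩ I) * (f 0 * P (E \ I)) := by gcongr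
    _ = P (E \ I) * (f 0 * P (E ∩ I)) := by ring
    _ ≤ _ := by gcongr

/-- Conditioning on survival increases the position of the walk stochastically. -/
lemma measure_mul_lintegral_walk_le {P : Measure Ω} [IsProbabilityMeasure P]
    (hX : ∀ i ∈ Finset.Icc 1 n, Measurable (X i))
    (hind : iIndepFun (fun i : Finset.Icc 1 n => X i) P) (hk : k ≤ n)
    {f : ℝ → ℝ≥0∞} (hf : Monotone f) :
    P (nonnegUpTo X u k) * ∫⁻ ω, f (walk X u k ω) ∂P
      ≤ ∫⁻ ω in nonnegUpTo X u k, f (walk X u k ω) ∂P := by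
  induction k generalizing f with
  | zero => simp [nonnegUpTo_zero]
  | succ k ih =>
    have hk' : k < n := by omega
    by_cases h0 : P (nonnegUpTo X u k) = 0
    · have : P (nonnegUpTo X u (k + 1)) = 0 :=
        measure_mono_null (by rw [nonnegUpTo_succ]; exact Set.inter_subset_left) h0
      simp [this]
    -- Averaging over the next increment preserves monotonicity, so the induction hypothesis applies
    -- to the averaged function.
    have h1 := ih hk'.le (f := fun x => ∫⁻ ω', f (x + X (k + 1) ω') ∂P)
      fun x y hxy => lintegral_mono fun ω => hf (by gcongr)
    rw [← lintegral_walk_succ hX hind hk' hf.measurable,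
      ← setLIntegral_walk_succ hX hind hk' hf.measurable] at h1
    have h2 := measure_mul_lintegral_le_of_monotone (P := P) (E := nonnegUpTo X u k)
      (measurable_walk (u := u) hX hk) hf
    rw [← nonnegUpTo_succ] at h2
    rw [← ENNReal.mul_le_mul_iff_right h0 (measure_ne_top _ _)]
    calc _ = P (nonnegUpTo X u (k + 1))
          * (P (nonnegUpTo X u k) * ∫⁻ ω, f (walk X u (k + 1) ω) ∂P) := by ring
      _ ≤ _ := by gcongr
      _ ≤ _ := h2

/-- A nonnegative function that is superharmonic on the half-line for every increment gives a
supermartingale for the killed walk. -/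
lemma setLIntegral_walk_le_of_superharmonic {P : Measure Ω} [IsProbabilityMeasure P]
    (hX : ∀ i ∈ Finset.Icc 1 n, Measurable (X i))
    (hind : iIndepFun (fun i : Finset.Icc 1 n => X i) P) (hu : 0 ≤ u) (hk : k ≤ n)
    {V : ℝ → ℝ≥0∞} (hV : Measurable V)
    (hsup : ∀ i ∈ Finset.Icc 1 n, ∀ x, 0 ≤ x → ∫⁻ ω, V (x + X i ω) ∂P ≤ V x) :
    ∫⁻ ω in nonnegUpTo X u k, V (walk X u k ω) ∂P ≤ V u := by
  induction k with
  | zero => simp [nonnegUpTo_zero, walk_zero]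
  | succ k ih =>
    have hk' : k < n := by omega
    refine le_trans ?_ (ih hk'.le)
    calc _ ≤ ∫⁻ ω in nonnegUpTo X u k, V (walk X u (k + 1) ω) ∂P :=
          lintegral_mono_set (by rw [nonnegUpTo_succ]; exact Set.inter_subset_left)
      _ = _ := setLIntegral_walk_succ hX hind hk' hV
      _ ≤ _ := setLIntegral_mono' (measurableSet_nonnegUpTo hX hk'.le) fun ω hω =>
          hsup _ (by simp; omega) _ (walk_nonneg_of_mem hu hω)

end Walk

/-! ### The Lyapunov function. -/

/-- Near `0`, replacing the Taylor coefficient `1/2` by `1/4` absorbs the cubic remainder; away from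
`0` the quartic term dominates `t ^ 2 / 4`. -/
lemma log_one_add_le {t : ℝ} (ht : -1 < t) :
    Real.log (1 + t) ≤ t - t ^ 2 / 4 + 42 * t ^ 4 := by
  by_cases h : |t| ≤ 1 / 10
  · have h1 := Real.abs_log_sub_add_sum_range_le (x := -t) (by rw [abs_neg]; linarith) 2
    simp only [Finset.sum_range_succ, Finset.sum_range_zero, abs_neg, sub_neg_eq_add] at h1
    norm_num at h1
    have h2 : |t| ^ 3 / (1 - |t|) ≤ t ^ 2 / 4 := by
      rw [div_le_iff₀ (by linarith), ← sq_abs t]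
      nlinarith [sq_nonneg |t|, mul_nonneg (sq_nonneg |t|) (sub_nonneg.2 h)]
    have h3 := (le_abs_self _).trans h1
    nlinarith [sq_nonneg (t ^ 2)]
  · have h1 := Real.log_le_sub_one_of_pos (x := 1 + t) (by linarith)
    have h2 : 1 / 100 ≤ t ^ 2 := by
      rw [← sq_abs]; nlinarith [not_le.1 h]
    nlinarith [sq_nonneg t]

/-- The Lyapunov function `z + log z`, cut off below `z = 1`, where `z = x + R`. -/
noncomputable def lyapunov (R x : ℝ) : ℝ :=
  if 1 ≤ x + R then x + R + Real.log (x + R) else 0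

lemma measurable_lyapunov (R : ℝ) : Measurable (lyapunov R) := by
  unfold lyapunov
  exact Measurable.ite (measurableSet_le measurable_const (by fun_prop)) (by fun_prop)
    measurable_const

lemma lyapunov_nonneg (R x : ℝ) : 0 ≤ lyapunov R x := by
  unfold lyapunov
  split_ifs with h
  · have := Real.log_nonneg h
    linarith
  · exact le_rfl

lemma le_lyapunov {R x : ℝ} (hR : 1 ≤ R) : max x 0 ≤ lyapunov R x := by
  refine max_le ?_ (lyapunov_nonneg R x)
  by_cases h : 1 ≤ x + R
  · have := Real.log_nonneg h
    rw [lyapunov, if_pos h]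
    linarith
  · have := lyapunov_nonneg R x
    linarith

lemma lyapunov_le {R x : ℝ} (hR : 1 ≤ R) (hx : 0 ≤ x) : lyapunov R x ≤ 2 * R * (x + 1) := by
  rw [lyapunov, if_pos (by linarith)]
  have := Real.log_le_sub_one_of_pos (x := x + R) (by linarith)
  nlinarith [mul_nonneg hx (sub_nonneg.2 hR)]

/-- In the scale `y = z t`, the quartic term is `21 z t⁴ ≥ 42 t⁴`, which covers the logarithm. It
also pays for the cutoff, which is reached only when `t ≤ -1/2`. -/
lemma lyapunov_add_le {R x : ℝ} (h : 2 ≤ x + R) (y : ℝ) :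
    lyapunov R (x + y) ≤ lyapunov R x + (1 + 1 / (x + R)) * y - 1 / (4 * (x + R) ^ 2) * y ^ 2
      + 21 / (x + R) ^ 3 * y ^ 4 := by
  have hz : lyapunov R x = x + R + Real.log (x + R) := by rw [lyapunov, if_pos (by linarith)]
  rw [hz]
  have hz' : lyapunov R (x + y) = if 1 ≤ x + R + y then x + R + y + Real.log (x + R + y) else 0 := by
    rw [lyapunov, show x + y + R = x + R + y by ring]
  rw [hz']
  generalize x + R = z at *
  have hpos : 0 < z := by linarith
  obtain ⟨t, rfl⟩ : ∃ t, y = z * t := ⟨y / z, by field_simp⟩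
  have e : z + Real.log z + (1 + 1 / z) * (z * t) - 1 / (4 * z ^ 2) * (z * t) ^ 2
      + 21 / z ^ 3 * (z * t) ^ 4
      = z + Real.log z + z * t + t - t ^ 2 / 4 + 21 * z * t ^ 4 := by
    field_simp; ring
  rw [e]
  have h4 : 2 * t ^ 4 ≤ z * t ^ 4 := by gcongr
  have hlog := Real.log_nonneg (x := z) (by linarith)
  split_ifs with hc
  · have ht : -1 < t := by
      by_contra hn
      nlinarith
    have h1 : z + z * t = z * (1 + t) := by ring
    rw [h1, Real.log_mul (by linarith) (by linarith)]
    have := log_one_add_le ht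
    linarith
  · have ht : t ≤ -1 / 2 := by
      by_contra hn
      nlinarith
    obtain ⟨r, rfl⟩ : ∃ r, t = -r := ⟨-t, by ring⟩
    have hr : 1 / 2 ≤ r := by linarith
    have h2 : r / 2 ≤ r ^ 2 := by nlinarith
    have h3 : r ^ 2 / 4 ≤ r ^ 4 := by nlinarith
    have h5 : 2 * (r ^ 4 * 8 - r) ≤ z * (r ^ 4 * 8 - r) := by
      apply mul_le_mul_of_nonneg_right h
      linarith
    have e4 : (-r) ^ 4 = r ^ 4 := by ring
    have e2 : (-r) ^ 2 = r ^ 2 := by ring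
    rw [e4] at *
    rw [e2]
    nlinarith

/-! ### Moments of one increment and superharmonicity. -/

section Moments

variable {Ω : Type*} [MeasurableSpace Ω] {P : Measure Ω} [IsProbabilityMeasure P] {f : Ω → ℝ}
  {A s : ℝ}

lemma integrable_pow_of_integrable_pow_four (hf : Measurable f)
    (h4 : Integrable (fun ω => f ω ^ 4) P) {p : ℕ} (hp : p ≤ 4) :
    Integrable (fun ω => f ω ^ p) P := by
  refine ((integrable_const (1 : ℝ)).fun_add h4).mono' (hf.pow_const p).aestronglyMeasurable
    (ae_of_all _ fun ω => ?_)
  simp only [norm_pow, Real.norm_eq_abs]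
  have h0 : 0 ≤ |f ω| := abs_nonneg _
  have e : f ω ^ 4 = |f ω| ^ 4 := ((by decide : Even 4).pow_abs _).symm
  rw [e]
  rcases le_total |f ω| 1 with h | h
  · have := pow_le_one₀ (n := p) h0 h
    have := pow_nonneg h0 4
    linarith
  · have := pow_le_pow_right₀ h hp
    linarith

lemma integrable_of_integrable_pow_four (hf : Measurable f)
    (h4 : Integrable (fun ω => f ω ^ 4) P) : Integrable f P := by
  simpa using integrable_pow_of_integrable_pow_four hf h4 (p := 1) (by norm_num)

lemma integral_sq_le_sqrt (hA : 0 < A) (hf : Measurable f)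
    (h4 : Integrable (fun ω => f ω ^ 4) P) (hb : ∫ ω, f ω ^ 4 ∂P ≤ A) :
    ∫ ω, f ω ^ 2 ∂P ≤ √A := by
  have hs : 0 < √A := Real.sqrt_pos.2 hA
  have hsq : √A ^ 2 = A := Real.sq_sqrt hA.le
  have h : ∫ ω, f ω ^ 2 ∂P ≤ ∫ ω, (f ω ^ 4 / (2 * √A) + √A / 2) ∂P := by
    refine integral_mono (integrable_pow_of_integrable_pow_four hf h4 (by norm_num))
      ((h4.div_const _).fun_add (integrable_const _)) fun ω => ?_
    have : f ω ^ 4 / (2 * √A) + √A / 2 - f ω ^ 2 = (f ω ^ 2 - √A) ^ 2 / (2 * √A) := by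
      field_simp; ring
    have h0 : 0 ≤ (f ω ^ 2 - √A) ^ 2 / (2 * √A) := by positivity
    dsimp only
    linarith
  rw [integral_add (h4.div_const _) (integrable_const _), integral_div] at h
  simp only [integral_const, probReal_univ, one_smul] at h
  have h2 : (∫ ω, f ω ^ 4 ∂P) / (2 * √A) ≤ √A / 2 := by
    rw [div_le_iff₀ (by positivity)]
    nlinarith
  linarith

lemma sq_le_integral_sq (hs : 0 < s) (hf : Measurable f)
    (h2 : Integrable (fun ω => f ω ^ 2) P)
    (hb : s ≤ ∫ ω, Set.indicator {ω | 0 < f ω} f ω ∂P) :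
    s ^ 2 ≤ ∫ ω, f ω ^ 2 ∂P := by
  have hI : Integrable f P := by
    refine ((integrable_const (1 : ℝ)).fun_add h2).mono' hf.aestronglyMeasurable
      (ae_of_all _ fun ω => ?_)
    simp only [Real.norm_eq_abs]
    rw [← sq_abs]
    nlinarith [sq_nonneg (|f ω| - 1), abs_nonneg (f ω)]
  have hm : MeasurableSet {ω | 0 < f ω} := measurableSet_lt measurable_const hf
  have h : ∫ ω, Set.indicator {ω | 0 < f ω} f ω ∂P ≤ ∫ ω, (f ω ^ 2 / (2 * s) + s / 2) ∂P := by
    refine integral_mono (hI.indicator hm) ((h2.div_const _).fun_add (integrable_const _)) fun ω => ?_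
    have e : f ω ^ 2 / (2 * s) + s / 2 - f ω = (f ω - s) ^ 2 / (2 * s) := by
      field_simp; ring
    have h0 : 0 ≤ (f ω - s) ^ 2 / (2 * s) := by positivity
    have h1 : 0 ≤ f ω ^ 2 / (2 * s) + s / 2 := by positivity
    by_cases hω : 0 < f ω
    · simp only [Set.indicator_apply, Set.mem_ofPred_eq, hω, if_true]
      linarith
    · simpa only [Set.indicator_apply, Set.mem_ofPred_eq, hω, if_false] using h1
  rw [integral_add (h2.div_const _) (integrable_const _), integral_div] at h
  simp only [integral_const, probReal_univ, one_smul] at h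
  have h3 : s / 2 ≤ (∫ ω, f ω ^ 2 ∂P) / (2 * s) := by linarith
  rw [le_div_iff₀ (by positivity)] at h3
  nlinarith

lemma lintegral_lyapunov_add_le (hs : 0 < s) (hf : Measurable f) (hmean : ∫ ω, f ω ∂P = 0)
    (h4 : Integrable (fun ω => f ω ^ 4) P) (hb : ∫ ω, f ω ^ 4 ∂P ≤ A)
    (h2 : s ^ 2 ≤ ∫ ω, f ω ^ 2 ∂P) {R x : ℝ} (hR : 2 ≤ R) (hR' : 84 * A / s ^ 2 ≤ R)
    (hx : 0 ≤ x) :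
    ∫⁻ ω, ENNReal.ofReal (lyapunov R (x + f ω)) ∂P ≤ ENNReal.ofReal (lyapunov R x) := by
  have hz2 : 2 ≤ x + R := by linarith
  have hpos : 0 < x + R := by linarith
  have hle := lyapunov_add_le hz2
  set a := 1 + 1 / (x + R)
  set b := 1 / (4 * (x + R) ^ 2) with hbdef
  set c := 21 / (x + R) ^ 3 with hcdef
  have i1 := (integrable_of_integrable_pow_four hf h4).const_mul a
  have i2 := (integrable_pow_of_integrable_pow_four hf h4 (p := 2) (by norm_num)).const_mul b
  have i4 := h4.const_mul c
  have i0 : Integrable (fun _ : Ω => lyapunov R x) P := integrable_const _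
  have i012 : Integrable (fun ω => lyapunov R x + a * f ω - b * f ω ^ 2) P :=
    (i0.fun_add i1).sub i2
  calc _ ≤ ∫⁻ ω, ENNReal.ofReal
        (lyapunov R x + a * f ω - b * f ω ^ 2 + c * f ω ^ 4) ∂P :=
        lintegral_mono fun ω => ENNReal.ofReal_le_ofReal (hle (f ω))
    _ = ENNReal.ofReal (∫ ω, (lyapunov R x + a * f ω - b * f ω ^ 2 + c * f ω ^ 4) ∂P) :=
        (ofReal_integral_eq_lintegral_ofReal (i012.fun_add i4)
          (ae_of_all _ fun ω => (lyapunov_nonneg _ _).trans (hle (f ω)))).symm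
    _ ≤ _ := by
        apply ENNReal.ofReal_le_ofReal
        rw [integral_add i012 i4, integral_sub (i0.fun_add i1) i2,
          integral_add i0 i1]
        simp only [integral_const_mul, hmean, integral_const, probReal_univ, one_smul, mul_zero,
          add_zero]
        have h3 : c * ∫ ω, f ω ^ 4 ∂P ≤ c * A := by gcongr
        have h5 : b * s ^ 2 ≤ b * ∫ ω, f ω ^ 2 ∂P := by gcongr
        -- With `z = x + R` this reads `21 A / z³ ≤ s² / (4 z²)`, whence the threshold `84 * A / s ^
        -- 2` for `R`.
        have h6 : c * A ≤ b * s ^ 2 := by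
          rw [div_le_iff₀ (by positivity)] at hR'
          have h7 : 84 * A ≤ (x + R) * s ^ 2 := by nlinarith [sq_nonneg s]
          have e : b * s ^ 2 - c * A = ((x + R) * s ^ 2 - 84 * A) / (4 * (x + R) ^ 3) := by
            rw [hbdef, hcdef]; field_simp; ring
          have : 0 ≤ ((x + R) * s ^ 2 - 84 * A) / (4 * (x + R) ^ 3) :=
            div_nonneg (by linarith) (by positivity)
          linarith
        linarith

end Moments

/-! ### Moments of the walk and the lower bound for its positive part. -/

section WalkMoments

variable {Ω : Type*} [MeasurableSpace Ω] {P : Measure Ω} [IsProbabilityMeasure P]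
  {X : ℕ → Ω → ℝ} {n k : ℕ} {A s : ℝ}

lemma walk_moments (hA : 0 < A) (hX : ∀ i ∈ Finset.Icc 1 n, Measurable (X i))
    (hind : iIndepFun (fun i : Finset.Icc 1 n => X i) P)
    (hmean : ∀ i ∈ Finset.Icc 1 n, ∫ ω, X i ω ∂P = 0)
    (h4 : ∀ i ∈ Finset.Icc 1 n,
      Integrable (fun ω => X i ω ^ 4) P ∧ ∫ ω, X i ω ^ 4 ∂P ≤ A)
    (h2 : ∀ i ∈ Finset.Icc 1 n, s ^ 2 ≤ ∫ ω, X i ω ^ 2 ∂P) (hk : k ≤ n) :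
    Integrable (fun ω => walk X 0 k ω ^ 4) P ∧ ∫ ω, walk X 0 k ω ∂P = 0 ∧
      k * s ^ 2 ≤ ∫ ω, walk X 0 k ω ^ 2 ∂P ∧ ∫ ω, walk X 0 k ω ^ 2 ∂P ≤ k * √A ∧
      ∫ ω, walk X 0 k ω ^ 4 ∂P ≤ 3 * k ^ 2 * A := by
  induction k with
  | zero => simp [walk_zero]
  | succ k ih =>
    have hk' : k < n := by omega
    have hi : k + 1 ∈ Finset.Icc 1 n := by simp; omega
    obtain ⟨W4, W1, W2, W2', W4'⟩ := ih hk'.le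
    have hWm : Measurable (walk X 0 k) := measurable_walk hX hk'.le
    have hYm := hX _ hi
    obtain ⟨Y4, Y4'⟩ := h4 _ hi
    have Y2 := h2 _ hi
    have Y2' := integral_sq_le_sqrt hA hYm Y4 Y4'
    have Y1 := hmean _ hi
    have hI : IndepFun (walk X 0 k) (X (k + 1)) P := indepFun_walk hX hind hk'
    simp_rw [walk_succ]
    generalize walk X 0 k = W at *
    generalize X (k + 1) = Y at *
    have hW : ∀ p ≤ 4, Integrable (fun ω => W ω ^ p) P := fun p hp =>
      integrable_pow_of_integrable_pow_four hWm W4 hp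
    have hY : ∀ p ≤ 4, Integrable (fun ω => Y ω ^ p) P := fun p hp =>
      integrable_pow_of_integrable_pow_four hYm Y4 hp
    have hind' : ∀ p q : ℕ, IndepFun (fun ω => W ω ^ p) (fun ω => Y ω ^ q) P := fun p q =>
      hI.comp (measurable_id.pow_const p) (measurable_id.pow_const q)
    have hint : ∀ p ≤ 4, ∀ q ≤ 4, Integrable (fun ω => W ω ^ p * Y ω ^ q) P :=
      fun p hp q hq => (hind' p q).integrable_mul (hW p hp) (hY q hq)
    have hmul : ∀ p q : ℕ,
        ∫ ω, W ω ^ p * Y ω ^ q ∂P = (∫ ω, W ω ^ p ∂P) * ∫ ω, Y ω ^ q ∂P := fun p q =>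
      (hind' p q).integral_fun_mul_eq_mul_integral (hWm.pow_const p).aestronglyMeasurable
        (hYm.pow_const q).aestronglyMeasurable
    have W1' : ∫ ω, W ω ^ 1 ∂P = 0 := by simpa using W1
    have Y1' : ∫ ω, Y ω ^ 1 ∂P = 0 := by simpa using Y1
    have j31 := (hint 3 (by norm_num) 1 (by norm_num)).const_mul 4
    have j22 := (hint 2 (by norm_num) 2 (by norm_num)).const_mul 6
    have j13 := (hint 1 (by norm_num) 3 (by norm_num)).const_mul 4
    have j11 := (hint 1 (by norm_num) 1 (by norm_num)).const_mul 2
    have w2 := hW 2 (by norm_num)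
    have y2 := hY 2 (by norm_num)
    have e4 : ∀ ω, (W ω + Y ω) ^ 4 = W ω ^ 4 + 4 * (W ω ^ 3 * Y ω ^ 1) + 6 * (W ω ^ 2 * Y ω ^ 2)
        + 4 * (W ω ^ 1 * Y ω ^ 3) + Y ω ^ 4 := fun ω => by ring
    have e2 : ∀ ω, (W ω + Y ω) ^ 2 = W ω ^ 2 + 2 * (W ω ^ 1 * Y ω ^ 1) + Y ω ^ 2 :=
      fun ω => by ring
    have m2 : ∫ ω, (W ω + Y ω) ^ 2 ∂P = ∫ ω, W ω ^ 2 ∂P + ∫ ω, Y ω ^ 2 ∂P := by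
      simp_rw [e2]
      rw [integral_add (w2.fun_add j11) y2, integral_add w2 j11, integral_const_mul, hmul, W1']
      ring
    have m4 : ∫ ω, (W ω + Y ω) ^ 4 ∂P = ∫ ω, W ω ^ 4 ∂P
        + 6 * ((∫ ω, W ω ^ 2 ∂P) * ∫ ω, Y ω ^ 2 ∂P) + ∫ ω, Y ω ^ 4 ∂P := by
      simp_rw [e4]
      rw [integral_add (((W4.fun_add j31).fun_add j22).fun_add j13) Y4,
        integral_add ((W4.fun_add j31).fun_add j22) j13, integral_add (W4.fun_add j31) j22,
        integral_add W4 j31]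
      simp only [integral_const_mul, hmul, W1', Y1']
      ring
    refine ⟨?_, ?_, ?_, ?_, ?_⟩
    · simp_rw [e4]
      exact (((W4.fun_add j31).fun_add j22).fun_add j13).fun_add Y4
    · rw [integral_add (by simpa using hW 1 (by norm_num)) (by simpa using hY 1 (by norm_num)),
        W1, Y1, add_zero]
    · rw [m2]; push_cast; linarith
    · rw [m2]; push_cast; linarith
    -- The induction closes because `3k² + 6k + 1 ≤ 3(k + 1)²`.
    · rw [m4]
      have hsq : √A * √A = A := Real.mul_self_sqrt hA.le
      have : (∫ ω, W ω ^ 2 ∂P) * ∫ ω, Y ω ^ 2 ∂P ≤ k * √A * √A :=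
        mul_le_mul W2' Y2' (integral_nonneg fun ω => sq_nonneg _) (by positivity)
      rw [mul_assoc, hsq] at this
      push_cast
      nlinarith

/-- With `r = |m| / l` this reduces to `r² - r⁴ ≤ r`. The linear term `m` turns `|m|` into the
positive part and vanishes on integrating a centred variable. -/
lemma sq_div_sub_le_two_mul_max {l : ℝ} (hl : 0 < l) (m : ℝ) :
    m + m ^ 2 / l - m ^ 4 / l ^ 3 ≤ 2 * max m 0 := by
  have h1 : 2 * max m 0 = m + |m| := by
    rcases le_total 0 m with h | h
    · rw [max_eq_left h, abs_of_nonneg h]; ring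
    · rw [max_eq_right h, abs_of_nonpos h]; ring
  have h2 : m ^ 2 / l - m ^ 4 / l ^ 3 ≤ |m| := by
    have e2 : m ^ 2 = |m| ^ 2 := (sq_abs m).symm
    have e4 : m ^ 4 = |m| ^ 4 := ((by decide : Even 4).pow_abs m).symm
    rw [e2, e4]
    have ha := abs_nonneg m
    generalize |m| = a at *
    obtain ⟨r, rfl⟩ : ∃ r, a = l * r := ⟨a / l, by field_simp⟩
    have hr : 0 ≤ r := nonneg_of_mul_nonneg_right ha hl
    have e : (l * r) ^ 2 / l - (l * r) ^ 4 / l ^ 3 = l * (r ^ 2 - r ^ 4) := by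
      field_simp
    rw [e]
    refine mul_le_mul_of_nonneg_left ?_ hl.le
    rcases le_total r 1 with h | h
    · nlinarith [pow_nonneg hr 4]
    · nlinarith [pow_le_pow_right₀ h (show 2 ≤ 4 by norm_num)]
  linarith

lemma integral_max_ge (f : Ω → ℝ) (hf : Measurable f) (h4 : Integrable (fun ω => f ω ^ 4) P)
    (h1 : ∫ ω, f ω ∂P = 0) {l : ℝ} (hl : 0 < l) :
    (∫ ω, f ω ^ 2 ∂P) / l - (∫ ω, f ω ^ 4 ∂P) / l ^ 3 ≤ 2 * ∫ ω, max (f ω) 0 ∂P := by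
  have i1 := integrable_of_integrable_pow_four hf h4
  have i2 := (integrable_pow_of_integrable_pow_four hf h4 (p := 2) (by norm_num)).div_const l
  have i4 := h4.div_const (l ^ 3)
  have h := integral_mono ((i1.fun_add i2).sub i4) (i1.pos_part.const_mul 2)
    fun ω => sq_div_sub_le_two_mul_max hl (f ω)
  simp only [Pi.sub_apply] at h
  rw [integral_sub (i1.fun_add i2) i4, integral_add i1 i2, integral_div, integral_div, h1,
    integral_const_mul, zero_add] at h
  exact h

end WalkMoments

/-! ### Conclusion. -/

theorem mainTheorem3 (A s : ℝ) (hA : 0 < A) (hs : 0 < s) :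
    ∃ c : ℝ, 0 < c ∧
      ∀ (n : ℕ), 1 ≤ n →
      ∀ (Ω : Type*) [MeasurableSpace Ω] (P : Measure Ω) [IsProbabilityMeasure P]
        (X : ℕ → Ω → ℝ),
        (∀ i ∈ Finset.Icc 1 n, Measurable (X i)) →
        iIndepFun (fun i : Finset.Icc 1 n => X i) P →
        (∀ i ∈ Finset.Icc 1 n, ∫ ω, X i ω ∂P = 0) →
        (∀ i ∈ Finset.Icc 1 n,
          Integrable (fun ω => X i ω ^ 4) P ∧ ∫ ω, X i ω ^ 4 ∂P ≤ A) →
        (∀ i ∈ Finset.Icc 1 n, s ≤ ∫ ω, Set.indicator {ω | 0 < X i ω} (X i) ω ∂P) →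
        ∀ u : ℝ, 0 ≤ u →
          P.real {ω | (n : WithTop ℕ) < firstNegTime X u ω} ≤ c * (u + 1) / √(n : ℝ) := by
  set R : ℝ := max 2 (84 * A / s ^ 2)
  have hR : 2 ≤ R := le_max_left _ _
  -- At scale `l = L √n`, this makes the fourth-moment loss exactly half of the second-moment gain.
  set L : ℝ := √(6 * A / s ^ 2) with hL
  have hLpos : 0 < L := Real.sqrt_pos.2 (by positivity)
  have hLsq : L ^ 2 = 6 * A / s ^ 2 := Real.sq_sqrt (by positivity)
  refine ⟨8 * R * L / s ^ 2, by positivity, ?_⟩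
  intro n hn Ω _ P _ X hX hind hmean h4 hpos u hu
  have h2 : ∀ i ∈ Finset.Icc 1 n, s ^ 2 ≤ ∫ ω, X i ω ^ 2 ∂P := fun i hi =>
    sq_le_integral_sq hs (hX i hi)
      (integrable_pow_of_integrable_pow_four (hX i hi) (h4 i hi).1 (by norm_num)) (hpos i hi)
  have hn0 : (0 : ℝ) < n := by exact_mod_cast hn
  have hsn : 0 < √(n : ℝ) := Real.sqrt_pos.2 hn0
  have hsn2 : √(n : ℝ) ^ 2 = n := Real.sq_sqrt hn0.le
  have hM : Measurable (walk X 0 n) := measurable_walk hX le_rfl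
  obtain ⟨M4, M1, M2, -, M4'⟩ := walk_moments hA hX hind hmean h4 h2 le_rfl
  have hlower : √(n : ℝ) * s ^ 2 / (4 * L) ≤ ∫ ω, max (walk X 0 n ω) 0 ∂P := by
    have hl : 0 < L * √(n : ℝ) := by positivity
    have h := integral_max_ge _ hM M4 M1 hl
    have a1 : n * s ^ 2 / (L * √(n : ℝ)) ≤ (∫ ω, walk X 0 n ω ^ 2 ∂P) / (L * √(n : ℝ)) := by
      gcongr
    have a2 : (∫ ω, walk X 0 n ω ^ 4 ∂P) / (L * √(n : ℝ)) ^ 3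
        ≤ 3 * n ^ 2 * A / (L * √(n : ℝ)) ^ 3 := by gcongr
    have e1 : n * s ^ 2 / (L * √(n : ℝ)) = √(n : ℝ) * s ^ 2 / L := by
      nth_rewrite 1 [← hsn2]
      field_simp
    have e2 : 3 * n ^ 2 * A / (L * √(n : ℝ)) ^ 3 = √(n : ℝ) * s ^ 2 / (2 * L) := by
      have : A = L ^ 2 * s ^ 2 / 6 := by rw [hLsq]; field_simp
      nth_rewrite 1 [← hsn2]
      rw [this]
      field_simp
      norm_num
    rw [e1] at a1
    rw [e2] at a2
    have e3 : √(n : ℝ) * s ^ 2 / L - √(n : ℝ) * s ^ 2 / (2 * L)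
        = 2 * (√(n : ℝ) * s ^ 2 / (4 * L)) := by field_simp; norm_num
    linarith
  have hmono : Monotone fun x : ℝ => ENNReal.ofReal (max x 0) := fun x y hxy =>
    ENNReal.ofReal_le_ofReal (max_le_max_right 0 hxy)
  have hup : P (nonnegUpTo X u n) * ENNReal.ofReal (√(n : ℝ) * s ^ 2 / (4 * L))
      ≤ ENNReal.ofReal (2 * R * (u + 1)) :=
    calc P (nonnegUpTo X u n) * ENNReal.ofReal (√(n : ℝ) * s ^ 2 / (4 * L))
        ≤ P (nonnegUpTo X u n) * ENNReal.ofReal (∫ ω, max (walk X 0 n ω) 0 ∂P) := by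
          gcongr
      _ = P (nonnegUpTo X u n) * ∫⁻ ω, ENNReal.ofReal (max (walk X 0 n ω) 0) ∂P := by
          rw [ofReal_integral_eq_lintegral_ofReal
            (integrable_of_integrable_pow_four hM M4).pos_part
            (ae_of_all _ fun ω => le_max_right _ _)]
      -- Starting from `u ≥ 0` instead of `0` only raises the walk.
      _ ≤ P (nonnegUpTo X u n) * ∫⁻ ω, ENNReal.ofReal (max (walk X u n ω) 0) ∂P := by
          gcongr with ω
          simp [walk, hu]
      _ ≤ ∫⁻ ω in nonnegUpTo X u n, ENNReal.ofReal (max (walk X u n ω) 0) ∂P :=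
          measure_mul_lintegral_walk_le hX hind le_rfl hmono
      _ ≤ ∫⁻ ω in nonnegUpTo X u n, ENNReal.ofReal (lyapunov R (walk X u n ω)) ∂P :=
          lintegral_mono fun ω => ENNReal.ofReal_le_ofReal (le_lyapunov (by linarith))
      _ ≤ ENNReal.ofReal (lyapunov R u) :=
          setLIntegral_walk_le_of_superharmonic (V := fun x => ENNReal.ofReal (lyapunov R x))
            hX hind hu le_rfl (measurable_lyapunov R).ennreal_ofReal fun i hi x hx =>
            lintegral_lyapunov_add_le hs (hX i hi) (hmean i hi) (h4 i hi).1 (h4 i hi).2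
              (h2 i hi) hR (le_max_right _ _) hx
      _ ≤ _ := ENNReal.ofReal_le_ofReal (lyapunov_le (by linarith) hu)
  have hreal := ENNReal.toReal_mono ENNReal.ofReal_ne_top hup
  rw [ENNReal.toReal_mul, ENNReal.toReal_ofReal (by positivity),
    ENNReal.toReal_ofReal (by positivity)] at hreal
  calc P.real {ω | (n : WithTop ℕ) < firstNegTime X u ω} ≤ P.real (nonnegUpTo X u n) :=
        measureReal_mono lt_firstNegTime_subset
    _ ≤ 2 * R * (u + 1) / (√(n : ℝ) * s ^ 2 / (4 * L)) := by
        rw [le_div_iff₀ (by positivity)]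
        exact hreal
    _ = 8 * R * L / s ^ 2 * (u + 1) / √(n : ℝ) := by
        field_simp
        norm_num
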